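/- Let $\mathbf S$ be a finite relational schema (relation symbols with arities $\ge 0$). An $\mathbf S$-instance is a set of facts $R(a_1,\dots,a_n)$ over a fixed infinite set of values, with $R\in\mathbf S$ and $n=\mathrm{arity}(R)$; it is finite unless said otherwise, and its active domain $\mathrm{adom}(I)$ is the set of values that occur in its facts. Fix $k\ge 0$. A ($k$-ary) pointed instance $(A,\mathbf a)$ is a finite instance $A$ with a $k$-tuple $\mathbf a$ of elements of $\mathrm{adom}(A)$. A homomorphism $(I,\mathbf a)\to(J,\mathbf b)$ is a map $\mathrm{adom}(I)\to\mathrm{adom}(J)$ that sends facts of $I$ to facts of $J$ and $\mathbf a$ to $\mathbf b$. The incidence graph of an instance is the bipartite multigraph whose nodes are its elements and its facts, with one edge between $a$ and $f$ for each occurrence of $a$ in $f$; $(A,\mathbf a)$ is c-acyclic if every cycle of the incidence graph of $A$ contains an element of $\mathbf a$. A TGD is a sentence $\forall\mathbf x\,(\phi(\mathbf x)\to\exists\mathbf y\,\psi(\mathbf x,\mathbf y))$ with $\phi,\psi$ finite conjunctions of relational atoms. It is monadic if all relations in its head $\psi$ are unary, and tree-shaped if the incidence graph of its body $\phi$ (the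 atoms of $\phi$ taken as the facts of an instance whose values are the variables) is acyclic. For a set $\Sigma$ of TGDs and a finite instance $I$, a solution for $I$ is a possibly infinite instance $J\supseteq I$ with $J\models\Sigma$, and $P_\Sigma(I)$ denotes a universal solution, i.e. a solution that maps to every solution by a homomorphism that is the identity on $\mathrm{adom}(I)$; it is unique up to homomorphic equivalence over $\mathrm{adom}(I)$. A set $F$ of pointed instances $(A,\mathbf a)$ with $A\models\Sigma$ has finite duality relative to $\Sigma$ if there is a finite set $D$ of pointed instances $(B,\mathbf b)$ with $B\models\Sigma$ such that, for every pointed instance $(C,\mathbf c)$ with $C\models\Sigma$, some member of $F$ maps homomorphically to $(C,\mathbf c)$ if and only if $(C,\mathbf c)$ maps homomorphically to no member of $D$. Theorem. Let $\Sigma$ be a finite set of tree-shaped monadic TGDs over $\mathbf S$, and let $F$ be a finite set of pairwise homomorphically incomparable $k$-ary pointed instances $(A,\mathbf a)$ with $A\models\Sigma$. Then the following are equivalent: 1. $F$ has finite duality relative to $\Sigma$. 2. Each $(A,\mathbf a)\in F$ is homomorphically equivalent to $(P_\Sigma(A'),\mathbf a')$ for some c-acyclic pointed instance $(A',\mathbf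 a')$. -/

import Mathlib

namespace TGDDuality

/-- A relational schema: relation symbols with arities (possibly `0`). Finiteness of the set of
relation symbols is a hypothesis where it is needed. -/
structure Schema where
  Rel : Type*
  arity : Rel → ℕ

/-- An expression `R(a₁, …, aₙ)` with `R` in the schema, `n = arity R` and `aᵢ` in `V`. It is a fact
when `V` is a set of values, and an atomic formula when `V` is a set of variables. -/
@[ext]
structure Atom (S : Schema) (V : Type*) where
  rel : S.Rel
  args : Fin (S.arity rel) → V

/-- Replace every argument of an atom by its image under `h`. -/
def Atom.map {S : Schema} {V W : Type*} (h : V → W) (f : Atom S V) : Atom S W :=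
  ⟨f.rel, fun i => h (f.args i)⟩

/-- A (finite or infinite) instance: a set of facts. -/
abbrev Instance (S : Schema) (V : Type*) := Set (Atom S V)

/-- The active domain: all values that occur in the facts of `I`. -/
def adom {S : Schema} {V : Type*} (I : Instance S V) : Set V :=
  {v | ∃ f ∈ I, ∃ i, f.args i = v}

/-- `h` maps every fact of `I` to a fact of `J`. Only the values of `h` on `adom I` matter, and `h`
automatically maps `adom I` into `adom J`. -/
def IsHom {S : Schema} {V W : Type*} (h : V → W) (I : Instance S V) (J : Instance S W) : Prop :=
  ∀ f ∈ I, f.map h ∈ J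

/-- `(I, a) → (J, b)`: there is a homomorphism from `I` to `J` that maps the tuple `a` to `b`. -/
def PointedHom {S : Schema} {V : Type*} {k : ℕ} (I : Instance S V) (a : Fin k → V)
    (J : Instance S V) (b : Fin k → V) : Prop :=
  ∃ h : V → V, IsHom h I J ∧ ∀ i, h (a i) = b i

/-- A `k`-ary pointed instance: a finite instance with a `k`-tuple of elements of its active
domain. -/
structure PointedInstance (S : Schema) (V : Type*) (k : ℕ) where
  inst : Instance S V
  finite_inst : inst.Finite
  pt : Fin k → V
  pt_mem : ∀ i, pt i ∈ adom inst

/-- Existence of a homomorphism between pointed instances. -/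
def PointedInstance.MapsTo {S : Schema} {V : Type*} {k : ℕ} (A B : PointedInstance S V k) : Prop :=
  PointedHom A.inst A.pt B.inst B.pt

/-- The incidence graph with parallel edges identified: nodes are the elements and the facts, and
a fact of `I` is adjacent to the elements that occur in it. -/
def incidenceGraph {S : Schema} {V : Type*} (I : Instance S V) : SimpleGraph (V ⊕ Atom S V) :=
  SimpleGraph.fromRel fun p q =>
    ∃ v f, p = Sum.inl v ∧ q = Sum.inr f ∧ f ∈ I ∧ ∃ i, f.args i = v

/-- Every cycle of the incidence multigraph of `I` contains an element of `X`. The multigraph has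
one edge between `v` and `f` for each occurrence of `v` in `f`, so that its cycles are the cycles of
length two formed by two occurrences of one element in one fact, and the cycles of the underlying
simple graph. -/
def EveryCycleMeets {S : Schema} {V : Type*} (I : Instance S V) (X : Set V) : Prop :=
  (∀ f ∈ I, ∀ i j, i ≠ j → f.args i = f.args j → f.args i ∈ X) ∧
  ∀ (p : V ⊕ Atom S V) (c : (incidenceGraph I).Walk p p), c.IsCycle →
    ∃ v ∈ X, Sum.inl v ∈ c.support

/-- The incidence multigraph of `I` has no cycle. -/
def Acyclic {S : Schema} {V : Type*} (I : Instance S V) : Prop :=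
  EveryCycleMeets I ∅

/-- Every cycle of the incidence multigraph contains a distinguished element. -/
def PointedInstance.CAcyclic {S : Schema} {V : Type*} {k : ℕ} (A : PointedInstance S V k) : Prop :=
  EveryCycleMeets A.inst (Set.range A.pt)

/-- A tuple-generating dependency `∀ x (φ(x) → ∃ y ψ(x, y))`, with variables in `ℕ`. Body and head
are finite sets of atoms (conjunctions); the variables of the head that do not occur in the body are
the existentially quantified ones. -/
structure TGD (S : Schema) where
  body : Set (Atom S ℕ)
  head : Set (Atom S ℕ)
  finite_body : body.Finite
  finite_head : head.Finite

/-- The TGD `t` holds in `I`. An assignment that satisfies a conjunction is the same as a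
homomorphism from the set of its atoms. -/
def TGD.HoldsIn {S : Schema} {V : Type*} (t : TGD S) (I : Instance S V) : Prop :=
  ∀ s : ℕ → V, IsHom s t.body I →
    ∃ s' : ℕ → V, (∀ x ∈ adom t.body, s' x = s x) ∧ IsHom s' t.head I

/-- `I ⊨ T` -/
def Models {S : Schema} {V : Type*} (I : Instance S V) (T : Set (TGD S)) : Prop :=
  ∀ t ∈ T, t.HoldsIn I

/-- All relations in the head are unary. -/
def TGD.IsMonadic {S : Schema} (t : TGD S) : Prop :=
  ∀ f ∈ t.head, S.arity f.rel = 1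

/-- The incidence multigraph of the body is acyclic (not necessarily connected). -/
def TGD.IsTreeShaped {S : Schema} (t : TGD S) : Prop :=
  Acyclic t.body

/-- `J` is a (possibly infinite) solution for `I` with respect to `T`. -/
def IsSolution {S : Schema} {V : Type*} (T : Set (TGD S)) (I J : Instance S V) : Prop :=
  I ⊆ J ∧ Models J T

/-- `J` is a universal solution for `I` with respect to `T`: a solution that maps to every solution,
finite or infinite, by a homomorphism that is the identity on `adom I`. Universal solutions are
unique up to homomorphic equivalence over `adom I`; `P_T(I)` denotes any of them. -/
def IsUniversalSolution {S : Schema} {V : Type*} (T : Set (TGD S)) (I J : Instance S V) : Prop :=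
  IsSolution T I J ∧
  ∀ J' : Instance S V, IsSolution T I J' → ∃ h : V → V, IsHom h J J' ∧ ∀ x ∈ adom I, h x = x

/-- `F` has finite duality relative to `T`: for some finite set `D` of pointed models of `T`, a
pointed model of `T` admits a homomorphism from a member of `F` if and only if it admits none to a
member of `D`. -/
def HasFiniteDuality {S : Schema} {V : Type*} {k : ℕ} (T : Set (TGD S))
    (F : Set (PointedInstance S V k)) : Prop :=
  ∃ D : Set (PointedInstance S V k), D.Finite ∧ (∀ B ∈ D, Models B.inst T) ∧
    ∀ C : PointedInstance S V k, Models C.inst T →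
      ((∃ A ∈ F, A.MapsTo C) ↔ ¬ ∃ B ∈ D, C.MapsTo B)

/-- `(A, a)` is homomorphically equivalent to `(P_T(A'), a')`. -/
def EquivUniversalSolution {S : Schema} {V : Type*} {k : ℕ} (T : Set (TGD S))
    (A A' : PointedInstance S V k) : Prop :=
  ∃ J : Instance S V, IsUniversalSolution T A'.inst J ∧
    PointedHom A.inst A.pt J A'.pt ∧ PointedHom J A'.pt A.inst A.pt

end TGDDuality

namespace TGDDuality

universe u

/-! From c-acyclicity to duality. By universality, `A` and `A'` map to the same finite models, so
the c-acyclic instances `A'` may stand in for `F`. Given a model `C` to which none of them maps,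
identify elements with equal neighbourhood types of radius `n + 1`, where `n` bounds the number of
facts of the TGD bodies and of the `A'`, and add every atom that looks like a fact of `C` from each
of its positions. The result has boundedly many elements, and `C` maps to it. A match of a small
forest-like pattern in it lifts to `C` fact by fact (`exists_lift`): each fact costs one level of
radius, and no cycle has to close up. Since the lift can be fixed at any one element, and unary
heads concern one variable at a time, the quotient is again a model; and no `A'` maps to it. So `D`
can consist of all models over a fixed finite domain to which no member of `F` maps.

From duality to c-acyclicity. Let `A₁` be the core of `A`. It is a model, hence its own universal
solution, so it suffices that it is c-acyclic. If a fact `f` lay on a cycle off the distinguished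
elements, take many copies of `A₁` glued at these elements and let `f` run only between different
copies (`twist`). This is a model, because heads are unary and `f` is not. By pigeonhole it maps to
no member of `D`, so a member of `F` maps to it, and incomparability makes this member `A`. Rigidity
of the core turns the map into a section of the projection to `A₁`. The section stays in one copy
along the rest of the cycle but changes copy across `f`, a contradiction. -/

/-! ### Atoms, homomorphisms, finiteness -/

theorem Atom.map_map {S : Schema} {U V W : Type*} (g : V → W) (h : U → V) (f : Atom S U) :
    (f.map h).map g = f.map (fun v => g (h v)) := rfl

theorem Atom.map_congr {S : Schema} {V W : Type*} {g h : V → W} {f : Atom S V}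
    (e : ∀ i, g (f.args i) = h (f.args i)) : f.map g = f.map h := by
  unfold Atom.map
  congr 1
  funext i
  exact e i

theorem Atom.map_eq_self {S : Schema} {V : Type*} {g : V → V} {f : Atom S V}
    (e : ∀ i, g (f.args i) = f.args i) : f.map g = f :=
  Atom.map_congr (h := id) e

theorem Atom.args_eq_of_map_eq {S : Schema} {V W : Type*} {g h : V → W} {f : Atom S V}
    (e : f.map g = f.map h) (i : Fin (S.arity f.rel)) : g (f.args i) = h (f.args i) := by
  simp only [Atom.map, Atom.mk.injEq, heq_eq_eq, true_and] at e
  exact congrFun e i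

theorem args_mem_adom {S : Schema} {V : Type*} {I : Instance S V} {f : Atom S V} (hf : f ∈ I)
    (i : Fin (S.arity f.rel)) : f.args i ∈ adom I :=
  ⟨f, hf, i, rfl⟩

theorem IsHom.mem_adom {S : Schema} {V W : Type*} {h : V → W} {I : Instance S V}
    {J : Instance S W} (hh : IsHom h I J) {v : V} (hv : v ∈ adom I) : h v ∈ adom J := by
  obtain ⟨f, hf, i, rfl⟩ := hv
  exact ⟨f.map h, hh f hf, i, rfl⟩

theorem IsHom.comp {S : Schema} {U V W : Type*} {g : V → W} {h : U → V} {I : Instance S U}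
    {J : Instance S V} {K : Instance S W} (hg : IsHom g J K) (hh : IsHom h I J) :
    IsHom (fun v => g (h v)) I K :=
  fun f hf => hg _ (hh f hf)

theorem IsHom.congr {S : Schema} {V W : Type*} {g h : V → W} {I : Instance S V}
    {J : Instance S W} (hg : IsHom g I J) (e : ∀ v ∈ adom I, g v = h v) : IsHom h I J := by
  intro f hf
  rw [← Atom.map_congr fun i => e _ (args_mem_adom hf i)]
  exact hg f hf

theorem finite_adom {S : Schema} {V : Type*} {I : Instance S V} (hI : I.Finite) :
    (adom I).Finite := by
  have : adom I = ⋃ f ∈ I, Set.range f.args := by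
    ext v
    simp [adom]
  rw [this]
  exact hI.biUnion fun f _ => Set.finite_range _

theorem finite_atoms {S : Schema} [Finite S.Rel] {V : Type*} {E : Set V} (hE : E.Finite) :
    {f : Atom S V | ∀ i, f.args i ∈ E}.Finite := by
  have := hE.to_subtype
  refine (Set.finite_range
    (fun p : Σ R : S.Rel, (Fin (S.arity R) → E) => (⟨p.1, fun i => p.2 i⟩ : Atom S V))).subset ?_
  intro f hf
  exact ⟨⟨f.rel, fun i => ⟨f.args i, hf i⟩⟩, rfl⟩

theorem PointedHom.trans {S : Schema} {V : Type*} {k : ℕ} {I J K : Instance S V}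
    {a b c : Fin k → V} (h₁ : PointedHom I a J b) (h₂ : PointedHom J b K c) :
    PointedHom I a K c := by
  obtain ⟨g, hg, hga⟩ := h₁
  obtain ⟨h, hh, hhb⟩ := h₂
  exact ⟨fun v => h (g v), hh.comp hg, fun i => by simp only [hga, hhb]⟩

theorem PointedInstance.MapsTo.refl {S : Schema} {V : Type*} {k : ℕ} (A : PointedInstance S V k) :
    A.MapsTo A :=
  ⟨id, fun _ hf => hf, fun _ => rfl⟩

theorem PointedInstance.MapsTo.trans {S : Schema} {V : Type*} {k : ℕ}
    {A B C : PointedInstance S V k} (h₁ : A.MapsTo B) (h₂ : B.MapsTo C) : A.MapsTo C :=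
  PointedHom.trans h₁ h₂

/-! ### Acyclicity as a property of connections -/

/-- `a` and `b` are linked in `I` by a sequence of facts and elements outside `X`. -/
def Conn {S : Schema} {V : Type*} (I : Instance S V) (X : Set V) : V → V → Prop :=
  Relation.ReflTransGen fun a b =>
    a ∉ X ∧ b ∉ X ∧ ∃ f ∈ I, (∃ i, f.args i = a) ∧ ∃ j, f.args j = b

theorem Conn.symm {S : Schema} {V : Type*} {I : Instance S V} {X : Set V} {a b : V}
    (h : Conn I X a b) : Conn I X b a := by
  have : Std.Symm (fun a b : V =>
      a ∉ X ∧ b ∉ X ∧ ∃ f ∈ I, (∃ i, f.args i = a) ∧ ∃ j, f.args j = b) :=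
    ⟨fun _ _ h => ⟨h.2.1, h.1, h.2.2.imp fun _ h => ⟨h.1, h.2.2, h.2.1⟩⟩⟩
  exact Relation.ReflTransGen.stdSymm.symm _ _ h

theorem Conn.mono {S : Schema} {V : Type*} {I J : Instance S V} {X : Set V} (hIJ : I ⊆ J)
    {a b : V} (h : Conn I X a b) : Conn J X a b :=
  Relation.ReflTransGen.mono
    (fun _ _ h => ⟨h.1, h.2.1, h.2.2.imp fun _ h => ⟨hIJ h.1, h.2⟩⟩) _ _ h

theorem conn_args {S : Schema} {V : Type*} {I : Instance S V} {X : Set V} {f : Atom S V}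
    (hf : f ∈ I) {i j : Fin (S.arity f.rel)} (hi : f.args i ∉ X) (hj : f.args j ∉ X) :
    Conn I X (f.args i) (f.args j) :=
  Relation.ReflTransGen.single ⟨hi, hj, f, hf, ⟨i, rfl⟩, ⟨j, rfl⟩⟩

/-- Two positions of a fact that carry elements outside `X` are not linked by the other facts. -/
def ForestOff {S : Schema} {V : Type*} (I : Instance S V) (X : Set V) : Prop :=
  ∀ f ∈ I, ∀ i j, i ≠ j → f.args i ∉ X → f.args j ∉ X →
    ¬ Conn (I \ {f}) X (f.args i) (f.args j)

theorem ForestOff.mono {S : Schema} {V : Type*} {I J : Instance S V} {X : Set V} (hIJ : I ⊆ J)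
    (h : ForestOff J X) : ForestOff I X :=
  fun f hf i j hij hi hj hc =>
    h f (hIJ hf) i j hij hi hj (hc.mono (Set.sdiff_subset_sdiff_left hIJ))

theorem incidenceGraph_adj_inl_inr {S : Schema} {V : Type*} {I : Instance S V} {v : V}
    {f : Atom S V} : (incidenceGraph I).Adj (Sum.inl v) (Sum.inr f) ↔
      f ∈ I ∧ ∃ i, f.args i = v := by
  simp [incidenceGraph, and_comm, eq_comm]

theorem incidenceGraph_not_adj_inl {S : Schema} {V : Type*} {I : Instance S V} {v w : V} :
    ¬ (incidenceGraph I).Adj (Sum.inl v) (Sum.inl w) := by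
  simp [incidenceGraph]

theorem incidenceGraph_not_adj_inr {S : Schema} {V : Type*} {I : Instance S V}
    {f g : Atom S V} : ¬ (incidenceGraph I).Adj (Sum.inr f) (Sum.inr g) := by
  simp [incidenceGraph]

/-- A walk that avoids `X` and the fact `f` yields a connection in `I \ {f}`. -/
theorem conn_of_walk {S : Schema} {V : Type*} {I : Instance S V} {X : Set V} {f : Atom S V}
    {p q : V ⊕ Atom S V} (c : (incidenceGraph I).Walk p q) (hf : Sum.inr f ∉ c.support)
    (hX : ∀ v, Sum.inl v ∈ c.support → v ∉ X) {y : V} (hq : q = Sum.inl y) :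
    (∀ x, p = Sum.inl x → Conn (I \ {f}) X x y) ∧
    ∀ g, p = Sum.inr g → ∃ i, g.args i ∉ X ∧ Conn (I \ {f}) X (g.args i) y := by
  induction c with
  | nil =>
    subst hq
    refine ⟨fun x hx => ?_, fun g hg => by simp at hg⟩
    obtain rfl := Sum.inl_injective hx
    exact Relation.ReflTransGen.refl
  | @cons a b d hab c ih =>
    have ih := ih (fun h => hf (by simp [h])) (fun v hv => hX v (by simp [hv])) hq
    refine ⟨?_, ?_⟩
    · rintro x rfl
      rcases b with b | g
      · exact absurd hab incidenceGraph_not_adj_inl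
      · obtain ⟨i, hi, hc⟩ := ih.2 g rfl
        obtain ⟨hg, j, hj⟩ := incidenceGraph_adj_inl_inr.1 hab
        refine Relation.ReflTransGen.head ⟨hX x (by simp), hi, g, ⟨hg, ?_⟩, ⟨j, hj⟩, ⟨i, rfl⟩⟩ hc
        rintro rfl
        exact hf (by simp)
    · rintro g rfl
      rcases b with b | g'
      · obtain ⟨hg, j, rfl⟩ := incidenceGraph_adj_inl_inr.1 hab.symm
        exact ⟨j, hX _ (by simp), ih.1 _ rfl⟩
      · exact absurd hab incidenceGraph_not_adj_inr

/-- A connection in `I \ {f}` yields a walk that avoids `X` and the fact `f`. -/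
theorem exists_walk_of_conn {S : Schema} {V : Type*} {I : Instance S V} {X : Set V}
    {f : Atom S V} {x y : V} (h : Conn (I \ {f}) X x y) (hy : y ∉ X) :
    ∃ c : (incidenceGraph I).Walk (Sum.inl x) (Sum.inl y), Sum.inr f ∉ c.support ∧
      ∀ v, Sum.inl v ∈ c.support → v ∉ X := by
  induction h using Relation.ReflTransGen.head_induction_on with
  | refl => exact ⟨.nil, by simp, by simpa using hy⟩
  | @head a b hab _ ih =>
    obtain ⟨c, hcf, hcX⟩ := ih
    obtain ⟨ha, hb, g, ⟨hg, hgf⟩, hga, hgb⟩ := hab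
    refine ⟨.cons (incidenceGraph_adj_inl_inr.2 ⟨hg, hga⟩)
      (.cons (incidenceGraph_adj_inl_inr.2 ⟨hg, hgb⟩).symm c), ?_, ?_⟩
    · simp only [SimpleGraph.Walk.support_cons, List.mem_cons, not_or]
      exact ⟨by simp, fun e => hgf (Sum.inr_injective e).symm, hcf⟩
    · intro v hv
      simp only [SimpleGraph.Walk.support_cons, List.mem_cons, Sum.inl.injEq, reduceCtorEq,
        false_or] at hv
      rcases hv with rfl | hv
      · exact ha
      · exact hcX v hv

/-- A link between two positions of `f` that avoids `f`, shortened to a path, closes up through `f`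
to a cycle off `X`. -/
theorem EveryCycleMeets.forestOff {S : Schema} {V : Type*} {I : Instance S V} {X : Set V}
    (h : EveryCycleMeets I X) : ForestOff I X := by
  classical
  intro f hf i j hij hi hj hc
  have hne : f.args i ≠ f.args j := fun e => hi (h.1 f hf i j hij e)
  obtain ⟨c, hcf, hcX⟩ := exists_walk_of_conn hc hj
  have hsub := c.support_bypass_subset_support
  have hadj : ∀ l, (incidenceGraph I).Adj (Sum.inl (f.args l)) (Sum.inr f) := fun l =>
    incidenceGraph_adj_inl_inr.2 ⟨hf, l, rfl⟩
  have hpath : (c.bypass.concat (hadj j)).IsPath :=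
    c.bypass_isPath.concat (fun h => hcf (hsub h)) _
  have hcyc : (SimpleGraph.Walk.cons (hadj i).symm (c.bypass.concat (hadj j))).IsCycle := by
    rw [SimpleGraph.Walk.cons_isCycle_iff]
    refine ⟨hpath, fun he => ?_⟩
    rw [SimpleGraph.Walk.edges_concat, List.concat_eq_append, List.mem_append,
      List.mem_singleton] at he
    rcases he with he | he
    · exact hcf (hsub (SimpleGraph.Walk.fst_mem_support_of_mem_edges _ he))
    · rw [Sym2.eq_iff] at he
      simp at he
      exact hne he
  obtain ⟨v, hv, hvc⟩ := h.2 _ _ hcyc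
  refine hcX v (hsub ?_) hv
  simpa [SimpleGraph.Walk.support_concat] using hvc

/-- Rotate a cycle off `X` to start at a fact `f`. Removing `f` leaves a link between two of its
positions, which differ because a cycle uses no edge twice. -/
theorem ForestOff.everyCycleMeets {S : Schema} {V : Type*} {I : Instance S V} {X : Set V}
    (h : ForestOff I X) : EveryCycleMeets I X := by
  classical
  refine ⟨fun f hf i j hij e => ?_, ?_⟩
  · by_contra hi
    exact h f hf i j hij hi (e ▸ hi) (e ▸ Relation.ReflTransGen.refl)
  · intro p c hc
    by_contra! hX
    have key : ∀ f : Atom S V, ∀ c : (incidenceGraph I).Walk (Sum.inr f) (Sum.inr f), c.IsCycle →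
        (∀ v ∈ X, Sum.inl v ∉ c.support) → False := by
      intro f c hc hX
      cases c with
      | nil => exact hc.ne_nil rfl
      | @cons _ a _ hab c =>
        obtain ⟨hpath, hedge⟩ := SimpleGraph.Walk.cons_isCycle_iff _ _ |>.1 hc
        rcases a with x | g
        swap
        · exact incidenceGraph_not_adj_inr hab
        obtain ⟨hf, i, rfl⟩ := incidenceGraph_adj_inl_inr.1 hab.symm
        obtain ⟨b, d, hb, hd⟩ : ∃ (b : V ⊕ Atom S V)
            (d : (incidenceGraph I).Walk (Sum.inl (f.args i)) b)
            (hb : (incidenceGraph I).Adj b (Sum.inr f)), c = d.concat hb := by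
          cases c with
          | cons h p => exact SimpleGraph.Walk.exists_cons_eq_concat h p
        subst hd
        rcases b with y | g
        swap
        · exact incidenceGraph_not_adj_inr hb
        obtain ⟨_, j, rfl⟩ := incidenceGraph_adj_inl_inr.1 hb
        have hij : i ≠ j := by
          rintro rfl
          apply hedge
          simp [SimpleGraph.Walk.edges_concat, Sym2.eq_swap]
        have hfd : Sum.inr f ∉ d.support := by
          have := hpath.support_nodup
          rw [SimpleGraph.Walk.support_concat] at this
          exact fun h => (List.nodup_append.1 this).2.2 _ h _ (by simp) rfl
        have hdX : ∀ v, Sum.inl v ∈ d.support → v ∉ X := by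
          intro v hv hvX
          refine hX v hvX ?_
          simp [SimpleGraph.Walk.support_concat, hv]
        exact h f hf i j hij (hdX _ (by simp)) (hdX _ (by simp))
          ((conn_of_walk d hfd hdX rfl).1 _ rfl)
    rcases p with x | f
    · cases c with
      | nil => exact hc.ne_nil rfl
      | @cons _ a _ hab c =>
        rcases a with y | f
        · exact incidenceGraph_not_adj_inl hab
        have hmem : Sum.inr f ∈ (SimpleGraph.Walk.cons hab c).support := by simp
        refine key f _ (hc.rotate hmem) fun v hv hvs => hX v hv ?_
        exact (SimpleGraph.Walk.mem_support_rotate_iff _ _ hmem).1 hvs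
    · exact key f c hc hX

/-! ### Neighbourhood types and lifting of forest-like patterns -/

/-- Descriptions of the neighbourhood of radius `n` of an element of an instance with `k`
distinguished elements. -/
def NbhdType (S : Schema.{u}) (k : ℕ) : ℕ → Type u
  | 0 => ULift.{u} (Set (Fin k))
  | n + 1 => NbhdType S k n ×
      Set (Σ R : S.Rel, Fin (S.arity R) × (Fin (S.arity R) → NbhdType S k n))

instance NbhdType.finite (S : Schema.{u}) [Finite S.Rel] (k : ℕ) : ∀ n, Finite (NbhdType S k n)
  | 0 => inferInstanceAs (Finite (ULift.{u} (Set (Fin k))))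
  | n + 1 => by
    have := NbhdType.finite S k n
    exact inferInstanceAs (Finite (NbhdType S k n ×
      Set (Σ R : S.Rel, Fin (S.arity R) × (Fin (S.arity R) → NbhdType S k n))))

section Types

variable {S : Schema.{u}} {V : Type*} {k : ℕ} (C : Instance S V) (c : Fin k → V)

/-- The neighbourhood of radius `n` of an element: which distinguished elements it equals, and in
which facts it occurs, up to the neighbourhoods of radius `n - 1` of their elements. -/
def nbhdType : (n : ℕ) → V → NbhdType S k n
  | 0, v => ⟨{i | c i = v}⟩
  | n + 1, v => (nbhdType n v,
      {p | ∃ w, (⟨p.1, w⟩ : Atom S V) ∈ C ∧ w p.2.1 = v ∧ (fun j => nbhdType n (w j)) = p.2.2})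

variable {C c}

theorem nbhdType_eq_of_succ {n : ℕ} {v w : V} (h : nbhdType C c (n + 1) v = nbhdType C c (n + 1) w) :
    nbhdType C c n v = nbhdType C c n w :=
  congrArg Prod.fst h

theorem nbhdType_eq_of_le {m n : ℕ} (hmn : m ≤ n) {v w : V}
    (h : nbhdType C c n v = nbhdType C c n w) : nbhdType C c m v = nbhdType C c m w := by
  induction hmn with
  | refl => exact h
  | step _ ih => exact ih (nbhdType_eq_of_succ h)

/-- Level `0` already records which distinguished elements a value equals, so the type of a
distinguished element determines it. -/
theorem eq_of_nbhdType_eq {n : ℕ} {v : V} {i : Fin k}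
    (h : nbhdType C c n v = nbhdType C c n (c i)) : v = c i := by
  have h0 : ({j | c j = v} : Set (Fin k)) = {j | c j = c i} :=
    congrArg ULift.down (nbhdType_eq_of_le (Nat.zero_le n) h)
  have : i ∈ ({j | c j = v} : Set (Fin k)) := h0 ▸ rfl
  exact this.symm

/-- The back-and-forth step: a fact is moved from one element to another of the same type, at the
price of one level of radius for its other elements. -/
theorem exists_fact_of_nbhdType_eq {n : ℕ} {v v' : V}
    (h : nbhdType C c (n + 1) v = nbhdType C c (n + 1) v') {R : S.Rel} {w : Fin (S.arity R) → V}
    (hw : (⟨R, w⟩ : Atom S V) ∈ C) {i : Fin (S.arity R)} (hi : w i = v) :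
    ∃ w', (⟨R, w'⟩ : Atom S V) ∈ C ∧ w' i = v' ∧
      ∀ j, nbhdType C c n (w' j) = nbhdType C c n (w j) := by
  have h1 := congrArg Prod.snd h
  have hmem : (⟨R, i, fun j => nbhdType C c n (w j)⟩ :
      Σ R : S.Rel, Fin (S.arity R) × (Fin (S.arity R) → NbhdType S k n)) ∈
      (nbhdType C c (n + 1) v).2 := ⟨w, hw, hi, rfl⟩
  rw [h1] at hmem
  obtain ⟨w', hw', hi', e⟩ := hmem
  exact ⟨w', hw', hi', fun j => congrFun e j⟩

variable (C c) in
/-- The atom looks like a fact of `C` from each of its elements, up to radius `n + 1`. -/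
def LooksLikeFact (n : ℕ) (f : Atom S V) : Prop :=
  (∃ g ∈ C, g.rel = f.rel) ∧ ∀ i, ∃ w, (⟨f.rel, w⟩ : Atom S V) ∈ C ∧
    nbhdType C c (n + 1) (w i) = nbhdType C c (n + 1) (f.args i) ∧
    ∀ j, nbhdType C c n (w j) = nbhdType C c n (f.args j)

theorem looksLikeFact_of_mem {n : ℕ} {f : Atom S V} (hf : f ∈ C) : LooksLikeFact C c n f :=
  ⟨⟨f, hf, rfl⟩, fun _ => ⟨f.args, hf, rfl, fun _ => rfl⟩⟩

/-- A map of a forest-like instance to atoms that look like facts of `C` can be corrected to a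
homomorphism, with prescribed values at pairwise unlinked elements. -/
theorem exists_lift {W : Type*} {X : Set W} {n : ℕ} (u : W → V) (hX : ∀ x ∈ X, ∃ i, u x = c i) :
    ∀ (m : ℕ), m ≤ n + 1 → ∀ (I : Instance S W), I.Finite → I.ncard ≤ m → ForestOff I X →
      (∀ f ∈ I, LooksLikeFact C c n (f.map u)) →
      ∀ (Y : Set W) (σ : W → V), (∀ x ∈ X, σ x = u x) →
      (∀ y ∈ Y, nbhdType C c m (σ y) = nbhdType C c m (u y)) →
      (∀ y ∈ Y, y ∉ X) → (∀ y ∈ Y, ∀ z ∈ Y, Conn I X y z → y = z) →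
      ∃ s : W → V, IsHom s I C ∧ (∀ x ∈ X, s x = u x) ∧ ∀ y ∈ Y, s y = σ y := by
  classical
  intro m
  induction m with
  | zero =>
    intro _ I hI hcard _ _ Y σ hσX _ _ _
    obtain rfl : I = ∅ := (Set.ncard_eq_zero hI).1 (Nat.le_zero.1 hcard)
    exact ⟨σ, fun _ h => h.elim, hσX, fun _ _ => rfl⟩
  | succ m ih =>
    intro hm I hI hcard hfor hu Y σ hσX hσY hYX hY
    rcases I.eq_empty_or_nonempty with rfl | ⟨f₀, hf₀⟩
    · exact ⟨σ, fun _ h => h.elim, hσX, fun _ _ => rfl⟩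
    -- `Y` is the set of roots, where the value is already fixed. Process a fact at a root if there
    -- is one; otherwise any fact will do.
    obtain ⟨f, hf, hroot⟩ : ∃ f ∈ I, (∃ i, f.args i ∈ Y) ∨ ∀ g ∈ I, ∀ i, g.args i ∉ Y := by
      by_cases h : ∃ f ∈ I, ∃ i, f.args i ∈ Y
      · exact h.imp fun f h => ⟨h.1, Or.inl h.2⟩
      · push Not at h
        exact ⟨f₀, hf₀, Or.inr h⟩
    have hXu : ∀ l : ℕ, ∀ x ∈ X, ∀ v, nbhdType C c l v = nbhdType C c l (u x) → v = u x := by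
      intro l x hx v hv
      obtain ⟨i, hi⟩ := hX x hx
      rw [hi] at hv ⊢
      exact eq_of_nbhdType_eq hv
    -- at most one root occurs in `f`
    have hone : ∀ i j, f.args i ∈ Y → f.args j ∈ Y → i = j := by
      intro i j hi hj
      have e := hY _ hi _ hj (conn_args hf (hYX _ hi) (hYX _ hj))
      by_contra hij
      exact hfor f hf i j hij (hYX _ hi) (hYX _ hj) (e ▸ Relation.ReflTransGen.refl)
    obtain ⟨w, hw, hwu, hwY⟩ : ∃ w, (⟨f.rel, w⟩ : Atom S V) ∈ C ∧
        (∀ j, nbhdType C c m (w j) = nbhdType C c m (u (f.args j))) ∧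
        ∀ j, f.args j ∈ Y → w j = σ (f.args j) := by
      obtain ⟨⟨g, hg, hgf⟩, hloc⟩ := hu f hf
      by_cases hi : ∃ i, f.args i ∈ Y
      · obtain ⟨i, hi⟩ := hi
        obtain ⟨w, hw, hwi, hwj⟩ := hloc i
        have e : nbhdType C c (m + 1) (w i) = nbhdType C c (m + 1) (σ (f.args i)) :=
          (nbhdType_eq_of_le hm hwi).trans (hσY _ hi).symm
        obtain ⟨w', hw', hwi', hwj'⟩ := exists_fact_of_nbhdType_eq e hw rfl
        refine ⟨w', hw', fun j => (hwj' j).trans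
          (nbhdType_eq_of_le (Nat.le_of_succ_le_succ hm) (hwj j)), fun j hj => ?_⟩
        obtain rfl := hone i j hi hj
        exact hwi'
      · by_cases h0 : Nonempty (Fin (S.arity f.rel))
        · obtain ⟨i⟩ := h0
          obtain ⟨w, hw, _, hwj⟩ := hloc i
          exact ⟨w, hw, fun j => nbhdType_eq_of_le (Nat.le_of_succ_le_succ hm) (hwj j),
            fun j hj => absurd ⟨j, hj⟩ hi⟩
        -- A nullary atom has no position to look from; here the first clause of `LooksLikeFact`
        -- supplies the fact.
        · have h0 := not_nonempty_iff.1 h0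
          obtain ⟨R, w⟩ := g
          change R = f.rel at hgf
          subst hgf
          exact ⟨w, hg, fun j => h0.elim j, fun j => h0.elim j⟩
    have hinj : ∀ i j, f.args i ∉ X → f.args i = f.args j → i = j := by
      intro i j hi e
      by_contra hij
      exact hfor f hf i j hij hi (e ▸ hi) (e ▸ Relation.ReflTransGen.refl)
    let σ' : W → V := fun z =>
      if z ∈ X then u z else if h : ∃ j, f.args j = z then w h.choose else σ z
    have hσ'f : ∀ j, σ' (f.args j) = w j := by
      intro j
      by_cases hj : f.args j ∈ X
      · simp only [σ', if_pos hj]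
        exact (hXu m _ hj _ (hwu j)).symm
      · have hex : ∃ i, f.args i = f.args j := ⟨j, rfl⟩
        simp only [σ', if_neg hj, dif_pos hex]
        congr 1
        exact hinj _ _ (by rw [hex.choose_spec]; exact hj) (by rw [hex.choose_spec])
    have hσ'Y : ∀ y ∈ Y, σ' y = σ y := by
      intro y hy
      by_cases h : ∃ j, f.args j = y
      · obtain ⟨j, rfl⟩ := h
        rw [hσ'f, hwY j hy]
      · simp only [σ', if_neg (hYX y hy), dif_neg h]
    have hsub : I \ {f} ⊆ I := Set.sdiff_subset
    -- a root is not linked to an element of `f` by the other facts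
    have hcross : ∀ y ∈ Y, ∀ j, f.args j ∉ X → Conn (I \ {f}) X y (f.args j) → y = f.args j := by
      intro y hy j hj hyj
      rcases hroot with ⟨i, hi⟩ | hno
      · have e := hY _ hy _ hi ((hyj.mono hsub).trans (conn_args hf hj (hYX _ hi)))
        subst e
        by_contra hne
        exact hfor f hf i j (fun e => hne (e ▸ rfl)) (hYX _ hi) hj hyj
      · rcases Relation.ReflTransGen.cases_head hyj with e | ⟨z, ⟨_, _, g, hg, ⟨i, hi⟩, _⟩, _⟩
        · exact e
        · exact absurd (hi ▸ hy) (hno g hg.1 i)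
    -- The elements of `f` off `X` become roots for the remaining facts. Forest-likeness keeps the
    -- roots unlinked once `f` is gone.
    obtain ⟨s, hs, hsX, hsY⟩ := ih (Nat.le_of_succ_le hm) (I \ {f}) (hI.subset hsub)
      (by have := Set.ncard_sdiff_singleton_lt_of_mem hf hI; omega) (hfor.mono hsub)
      (fun g hg => hu g hg.1) (Y ∪ {z | z ∉ X ∧ ∃ j, f.args j = z}) σ'
      (fun x hx => if_pos hx)
      (by
        rintro y (hy | ⟨_, j, rfl⟩)
        · rw [hσ'Y y hy]
          exact nbhdType_eq_of_succ (hσY y hy)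
        · rw [hσ'f]
          exact hwu j)
      (by
        rintro y (hy | ⟨hy, _⟩)
        · exact hYX y hy
        · exact hy)
      (by
        rintro y (hy | ⟨hyX, i, rfl⟩) z (hz | ⟨hzX, j, rfl⟩) hyz
        · exact hY y hy z hz (hyz.mono hsub)
        · exact hcross y hy j hzX hyz
        · exact (hcross z hz i hyX hyz.symm).symm
        · by_contra hne
          exact hfor f hf i j (fun e => hne (e ▸ rfl)) hyX hzX hyz)
    refine ⟨s, fun g hg => ?_, hsX, fun y hy => (hsY y (Or.inl hy)).trans (hσ'Y y hy)⟩
    by_cases hgf : g = f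
    · subst hgf
      have e : g.map s = ⟨g.rel, w⟩ := by
        unfold Atom.map
        congr 1
        funext j
        rw [← hσ'f j]
        by_cases hj : g.args j ∈ X
        · rw [hsX _ hj]
          exact (if_pos hj).symm
        · exact hsY _ (Or.inr ⟨hj, j, rfl⟩)
      rw [e]
      exact hw
    · exact hs g ⟨hg, hgf⟩

end Types

/-! ### The type quotient -/

section Quotient

variable {S : Schema.{u}} {V : Type*} {k : ℕ} (C : Instance S V) (c : Fin k → V) (n : ℕ)
  (e : NbhdType S k (n + 1) → V)

/-- The name of the neighbourhood of radius `n + 1` of an element. -/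
def typeName (v : V) : V := e (nbhdType C c (n + 1) v)

/-- The quotient of `C` by equality of neighbourhoods of radius `n + 1`, with all facts that look
like facts of `C` from each of their elements. -/
def typeQuotient : Instance S V :=
  Atom.map (typeName C c n e) '' {f | LooksLikeFact C c n f}

variable {C c n e}

theorem isHom_typeName : IsHom (typeName C c n e) C (typeQuotient C c n e) :=
  fun f hf => ⟨f, looksLikeFact_of_mem hf, rfl⟩

theorem adom_typeQuotient_subset : adom (typeQuotient C c n e) ⊆ Set.range e := by
  rintro _ ⟨_, ⟨f, _, rfl⟩, i, rfl⟩
  exact ⟨_, rfl⟩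

/-- A homomorphism from a small forest-like instance to the type quotient lifts to `C`, with a
value at one element that can be prescribed up to its type. -/
theorem exists_lift_of_isHom_typeQuotient (he : Function.Injective e) {W : Type*}
    {I : Instance S W} (hI : I.Finite) (hcard : I.ncard ≤ n + 1) {X : Set W} (hfor : ForestOff I X)
    {s : W → V} (hs : IsHom s I (typeQuotient C c n e))
    (hX : ∀ x ∈ X, ∃ i, s x = typeName C c n e (c i)) :
    ∃ u : W → V, (∀ x ∈ adom I, typeName C c n e (u x) = s x) ∧
      (∀ x ∈ X, ∀ i, s x = typeName C c n e (c i) → u x = c i) ∧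
      ∀ x, ∃ s' : W → V, IsHom s' I C ∧ (∀ z ∈ X, s' z = u z) ∧ s' x = u x := by
  classical
  -- A representative in `C` of each class. Representatives of the elements of one fact need not
  -- form a fact of `C`, so `u` itself is not the lift.
  let u : W → V := fun x => if h : ∃ v, typeName C c n e v = s x then h.choose else s x
  have hu : ∀ x, (∃ v, typeName C c n e v = s x) → typeName C c n e (u x) = s x := by
    intro x h
    simp only [u, dif_pos h]
    exact h.choose_spec
  have huX : ∀ x ∈ X, ∀ i, s x = typeName C c n e (c i) → u x = c i := by
    intro x _ i hi
    exact eq_of_nbhdType_eq (he ((hu x ⟨_, hi.symm⟩).trans hi))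
  refine ⟨u, ?_, huX, fun x => ?_⟩
  · rintro _ ⟨f, hf, i, rfl⟩
    refine hu _ ?_
    obtain ⟨_, ⟨g, _, rfl⟩, j, hj⟩ := hs.mem_adom (args_mem_adom hf i)
    exact ⟨g.args j, hj⟩
  · have hlook : ∀ f ∈ I, LooksLikeFact C c n (f.map u) := by
      intro f hf
      obtain ⟨g, hg, hgf⟩ := hs f hf
      obtain ⟨R, w⟩ := f
      obtain ⟨R', w'⟩ := g
      simp only [Atom.map, Atom.mk.injEq] at hgf
      obtain ⟨rfl, hgf⟩ := hgf
      have key : ∀ i, nbhdType C c (n + 1) (u (w i)) = nbhdType C c (n + 1) (w' i) := by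
        intro i
        have e1 := congrFun (eq_of_heq hgf) i
        exact he ((hu (w i) ⟨_, e1⟩).trans e1.symm)
      refine ⟨hg.1, fun i => ?_⟩
      obtain ⟨w₁, hw₁, hi, hj⟩ := hg.2 i
      exact ⟨w₁, hw₁, hi.trans (key i).symm,
        fun j => (hj j).trans (nbhdType_eq_of_succ (key j)).symm⟩
    obtain ⟨s', hs', hs'X, hs'x⟩ := exists_lift u
      (fun z hz => (hX z hz).imp fun i hi => huX z hz i hi) (n + 1) le_rfl I hI hcard hfor hlook
      ({x} \ X) u (fun _ _ => rfl) (fun _ _ => rfl) (fun _ hy => hy.2)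
      (fun y hy z hz _ => hy.1.trans hz.1.symm)
    refine ⟨s', hs', hs'X, ?_⟩
    by_cases hx : x ∈ X
    · exact hs'X x hx
    · exact hs'x x ⟨rfl, hx⟩

/-- Tree-shaped monadic TGDs with small bodies are preserved by the type quotient. -/
theorem TGD.HoldsIn.typeQuotient (he : Function.Injective e) {t : TGD S} (hmon : t.IsMonadic)
    (htree : t.IsTreeShaped) (hcard : t.body.ncard ≤ n + 1) (ht : t.HoldsIn C) :
    t.HoldsIn (typeQuotient C c n e) := by
  classical
  intro s hs
  obtain ⟨u, hu, _, hlift⟩ := exists_lift_of_isHom_typeQuotient he t.finite_body hcard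
    (EveryCycleMeets.forestOff htree) hs (fun x hx => hx.elim)
  -- Each body variable has its own lift to `C`, exact at that variable. This suffices because each
  -- head atom contains only one variable.
  have hhead : ∀ x, ∃ s' : ℕ → V, IsHom s' t.head C ∧ (x ∈ adom t.body → s' x = u x) := by
    intro x
    obtain ⟨s₁, hs₁, _, hx⟩ := hlift x
    obtain ⟨s₂, hs₂, hhd⟩ := ht s₁ hs₁
    exact ⟨s₂, hhd, fun h => (hs₂ x h).trans hx⟩
  -- A single lift serves all existential variables, so head atoms that share one agree on it; the
  -- index `0` is arbitrary.
  obtain ⟨s₀, hs₀, _⟩ := hhead 0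
  refine ⟨fun x => if x ∈ adom t.body then s x else typeName C c n e (s₀ x),
    fun x hx => if_pos hx, fun f hf => ?_⟩
  have h1 := hmon f hf
  have hi : ∀ i j : Fin (S.arity f.rel), i = j := fun i j => Fin.ext (by omega)
  let i₀ : Fin (S.arity f.rel) := ⟨0, by omega⟩
  by_cases hx : f.args i₀ ∈ adom t.body
  · obtain ⟨s', hs', hs'x⟩ := hhead (f.args i₀)
    have := isHom_typeName (c := c) (n := n) (e := e) _ (hs' f hf)
    rw [Atom.map_map] at this
    rw [Atom.map_congr (h := fun v => typeName C c n e (s' v))]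
    · exact this
    · intro i
      rw [hi i i₀, if_pos hx, hs'x hx, hu _ hx]
  · have := isHom_typeName (c := c) (n := n) (e := e) _ (hs₀ f hf)
    rw [Atom.map_map] at this
    rw [Atom.map_congr (h := fun v => typeName C c n e (s₀ v))]
    · exact this
    · intro i
      rw [hi i i₀, if_neg hx]

end Quotient

/-! ### From c-acyclicity to finite duality -/

theorem nonempty_embedding_of_finite_of_infinite (α β : Type*) [Finite α] [Infinite β] :
    Nonempty (α ↪ β) := by
  obtain ⟨n, ⟨f⟩⟩ := Finite.exists_equiv_fin α
  exact ⟨f.toEmbedding.trans (Fin.valEmbedding.trans (Infinite.natEmbedding β))⟩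

/-- Models without a homomorphism from given c-acyclic instances map to such models over a fixed
finite domain. -/
theorem exists_bounded_targets {S : Schema.{u}} [Finite S.Rel] {V : Type*} [Infinite V] {k : ℕ}
    {T : Set (TGD S)} (hT : T.Finite) (hmon : ∀ t ∈ T, t.IsMonadic)
    (htree : ∀ t ∈ T, t.IsTreeShaped) {F : Set (PointedInstance S V k)} (hF : F.Finite)
    (hacyc : ∀ A ∈ F, A.CAcyclic) :
    ∃ E : Set V, E.Finite ∧ ∀ C : PointedInstance S V k, Models C.inst T →
      (∀ A ∈ F, ¬ A.MapsTo C) → ∃ B : PointedInstance S V k, adom B.inst ⊆ E ∧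
        Models B.inst T ∧ (∀ A ∈ F, ¬ A.MapsTo B) ∧ C.MapsTo B := by
  obtain ⟨n₁, hn₁⟩ := (hT.image fun t => t.body.ncard).bddAbove
  obtain ⟨n₂, hn₂⟩ := (hF.image fun A => A.inst.ncard).bddAbove
  let n := max n₁ n₂
  obtain ⟨e⟩ := nonempty_embedding_of_finite_of_infinite (NbhdType S k (n + 1)) V
  refine ⟨Set.range e, Set.finite_range e, fun C hC hAC => ?_⟩
  let h := typeName C.inst C.pt n e
  have hh : IsHom h C.inst (typeQuotient C.inst C.pt n e) := isHom_typeName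
  refine ⟨⟨typeQuotient C.inst C.pt n e, ?_, fun i => h (C.pt i), fun i => hh.mem_adom (C.pt_mem i)⟩,
    adom_typeQuotient_subset, ?_, ?_, h, hh, fun _ => rfl⟩
  · exact (finite_atoms (Set.finite_range e)).subset fun f hf i =>
      adom_typeQuotient_subset (args_mem_adom hf i)
  · intro t ht
    refine (hC t ht).typeQuotient e.injective (hmon t ht) (htree t ht) ?_
    have : t.body.ncard ≤ n₁ := hn₁ ⟨t, ht, rfl⟩
    omega
  · rintro A hA ⟨s, hs, hpt⟩
    have hcard : A.inst.ncard ≤ n₂ := hn₂ ⟨A, hA, rfl⟩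
    obtain ⟨u, _, huX, hlift⟩ := exists_lift_of_isHom_typeQuotient e.injective A.finite_inst
      (by omega) (hacyc A hA).forestOff hs (by
        rintro _ ⟨i, rfl⟩
        exact ⟨i, hpt i⟩)
    obtain ⟨s', hs', hs'X, _⟩ := hlift (Classical.arbitrary V)
    exact hAC A hA ⟨s', hs', fun i => (hs'X _ ⟨i, rfl⟩).trans (huX _ ⟨i, rfl⟩ i (hpt i))⟩

theorem finite_pointedInstances {S : Schema} [Finite S.Rel] {V : Type*} {k : ℕ} {E : Set V}
    (hE : E.Finite) : {B : PointedInstance S V k | adom B.inst ⊆ E}.Finite := by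
  have h1 := (finite_atoms (S := S) hE).powerset
  have h2 : {p : Fin k → V | ∀ i, p i ∈ E}.Finite := Set.Finite.pi' fun _ => hE
  refine Set.Finite.of_finite_image (f := fun B : PointedInstance S V k => (B.inst, B.pt))
    ((h1.prod h2).subset ?_) ?_
  · rintro _ ⟨B, hB, rfl⟩
    exact ⟨fun f hf i => hB (args_mem_adom hf i), fun i => hB (B.pt_mem i)⟩
  · rintro ⟨I, hI, p, hp⟩ _ ⟨J, hJ, q, hq⟩ _ h
    simp only [Prod.mk.injEq] at h
    obtain ⟨rfl, rfl⟩ := h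
    rfl

/-- A homomorphism to a finite model extends to the universal solution. -/
theorem IsUniversalSolution.pointedHom {S : Schema} {V : Type*} [Infinite V] {k : ℕ}
    {T : Set (TGD S)} {A C : PointedInstance S V k} {J : Instance S V}
    (hJ : IsUniversalSolution T A.inst J) (hC : Models C.inst T) (h : A.MapsTo C) :
    PointedHom J A.pt C.inst C.pt := by
  classical
  obtain ⟨h, hh, hpt⟩ := h
  have := (finite_adom C.finite_inst).to_subtype
  have := (finite_adom A.finite_inst).infinite_compl.to_subtype
  obtain ⟨ι⟩ := nonempty_embedding_of_finite_of_infinite (adom C.inst) ((adom A.inst)ᶜ : Set V)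
  have hι : Function.Injective fun v => (ι v : V) := Subtype.val_injective.comp ι.injective
  -- Universality needs a solution that contains `A`. Let `g` be `h` on `adom A` and map a disjoint
  -- copy of `adom C` back onto `adom C`; the preimage of `C` under `g` is then such a solution.
  let g : V → V := Function.extend (fun v => (ι v : V)) Subtype.val h
  have hgA : ∀ v ∈ adom A.inst, g v = h v := by
    intro v hv
    refine Function.extend_apply' _ _ _ ?_
    rintro ⟨w, rfl⟩
    exact (ι w).2 hv
  have hgC : ∀ v : adom C.inst, g (ι v) = v := fun v => hι.extend_apply _ _ v
  obtain ⟨j, hj, hjA⟩ := hJ.2 {f | f.map g ∈ C.inst}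
    ⟨fun f hf => hh.congr (fun v hv => (hgA v hv).symm) f hf, by
      intro t ht s hs
      obtain ⟨s', hs', hhd⟩ := hC t ht (fun x => g (s x)) hs
      refine ⟨fun x => if x ∈ adom t.body then s x else
        if hx : s' x ∈ adom C.inst then ι ⟨s' x, hx⟩ else s x, fun x hx => if_pos hx, ?_⟩
      intro f hf
      have hf' := hhd f hf
      change (f.map _).map g ∈ C.inst
      rw [Atom.map_map, Atom.map_congr (h := s')]
      · exact hf'
      · intro i
        by_cases hx : f.args i ∈ adom t.body
        · simp only [if_pos hx, hs' _ hx]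
        · have hm : s' (f.args i) ∈ adom C.inst := args_mem_adom hf' i
          simp only [if_neg hx, dif_pos hm]
          exact hgC ⟨_, hm⟩⟩
  refine ⟨fun v => g (j v), fun f hf => hj f hf, fun i => ?_⟩
  simp only [hjA _ (A.pt_mem i), hgA _ (A.pt_mem i), hpt]

theorem EquivUniversalSolution.mapsTo_iff {S : Schema} {V : Type*} [Infinite V] {k : ℕ}
    {T : Set (TGD S)} {A A' C : PointedInstance S V k} (h : EquivUniversalSolution T A A')
    (hC : Models C.inst T) : A.MapsTo C ↔ A'.MapsTo C := by
  obtain ⟨J, hJ, hAJ, hJA⟩ := h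
  refine ⟨fun hAC => ?_, fun hAC => hAJ.trans (hJ.pointedHom hC hAC)⟩
  exact PointedHom.trans ⟨id, fun f hf => hJ.1.1 hf, fun _ => rfl⟩ (hJA.trans hAC)

theorem hasFiniteDuality_of_cAcyclic {S : Schema} [Finite S.Rel] {V : Type*} [Infinite V] {k : ℕ}
    {T : Set (TGD S)} (hT : T.Finite) (hmon : ∀ t ∈ T, t.IsMonadic)
    (htree : ∀ t ∈ T, t.IsTreeShaped) {F : Set (PointedInstance S V k)} (hF : F.Finite)
    (h : ∀ A ∈ F, ∃ A' : PointedInstance S V k, A'.CAcyclic ∧ EquivUniversalSolution T A A') :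
    HasFiniteDuality T F := by
  choose! φ hφ hequiv using h
  obtain ⟨E, hE, hB⟩ := exists_bounded_targets hT hmon htree (hF.image φ) (by
    rintro _ ⟨A, hA, rfl⟩
    exact hφ A hA)
  refine ⟨{B | adom B.inst ⊆ E ∧ Models B.inst T ∧ ∀ A ∈ F, ¬ A.MapsTo B},
    (finite_pointedInstances hE).subset fun _ h => h.1, fun _ h => h.2.1, fun C hC => ?_⟩
  constructor
  · rintro ⟨A, hA, hAC⟩ ⟨B, ⟨_, _, hB⟩, hCB⟩
    exact hB A hA (hAC.trans hCB)
  · intro hCD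
    by_contra! hAC
    obtain ⟨B, hBE, hBT, hAB, hCB⟩ := hB C hC (by
      rintro _ ⟨A, hA, rfl⟩ hA'
      exact hAC A hA (((hequiv A hA).mapsTo_iff hC).2 hA'))
    exact hCD ⟨B, ⟨hBE, hBT, fun A hA hA' =>
      hAB _ ⟨A, hA, rfl⟩ (((hequiv A hA).mapsTo_iff hBT).1 hA')⟩, hCB⟩

/-! ### Cores of finite models -/

/-- Some iterate of a self-map of a finite set is idempotent on it. -/
theorem exists_iterate_idempotentOn {V : Type*} {P : Set V} (hP : P.Finite) {h : V → V}
    (hh : Set.MapsTo h P P) : ∃ n, ∀ x ∈ P, h^[n + 1] (h^[n + 1] x) = h^[n + 1] x := by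
  have := hP.to_subtype
  let g : P → P := hh.restrict
  obtain ⟨a, b, hab, e⟩ : ∃ a b, a < b ∧ g^[a] = g^[b] := by
    obtain ⟨a, b, hne, e⟩ := Finite.exists_ne_map_eq_of_infinite (fun n : ℕ => g^[n])
    rcases lt_or_gt_of_ne hne with h | h
    · exact ⟨a, b, h, e⟩
    · exact ⟨b, a, h, e.symm⟩
  obtain ⟨d, rfl⟩ := Nat.exists_eq_add_of_lt hab
  have hper : ∀ r m, a ≤ m → g^[m + r * (d + 1)] = g^[m] := by
    intro r m hm
    induction r with
    | zero => simp
    | succ r ih =>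
      obtain ⟨l, rfl⟩ := Nat.exists_eq_add_of_le hm
      have : a + l + (r + 1) * (d + 1) = (l + r * (d + 1)) + (a + d + 1) := by ring
      rw [this, Function.iterate_add, ← e, ← Function.iterate_add, ← ih]
      congr 1
      ring
  -- A positive multiple of the period `d + 1` beyond the preperiod `a`: iterating as often again
  -- changes nothing.
  obtain ⟨n, hn⟩ : ∃ n, n + 1 = (a + 1) * (d + 1) := ⟨(a + 1) * (d + 1) - 1, by
    have : 0 < (a + 1) * (d + 1) := by positivity
    omega⟩
  refine ⟨n, fun x hx => ?_⟩
  have hidem : g^[n + 1] (g^[n + 1] ⟨x, hx⟩) = g^[n + 1] ⟨x, hx⟩ := by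
    rw [← Function.iterate_add_apply]
    have := hper (a + 1) (n + 1) (by rw [hn]; nlinarith)
    rw [← hn] at this
    rw [this]
  have hval : ∀ m (y : P), ((g^[m] y : P) : V) = h^[m] y := by
    intro m
    induction m with
    | zero => intro y; rfl
    | succ m ih => intro y; rw [Function.iterate_succ_apply, Function.iterate_succ_apply, ih]; rfl
  have := congrArg Subtype.val hidem
  rwa [hval, hval] at this

theorem IsHom.iterate {S : Schema} {V : Type*} {h : V → V} {I : Instance S V} (hh : IsHom h I I)
    (n : ℕ) : IsHom h^[n] I I := by
  induction n with
  | zero => exact fun f hf => hf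
  | succ n ih => exact ih.comp hh

/-- A retract of a model of a TGD is a model. -/
theorem TGD.HoldsIn.retract {S : Schema} {V : Type*} {I : Instance S V} {t : TGD S}
    (ht : t.HoldsIn I) {e : V → V} (he : IsHom e I I) (hid : ∀ v ∈ adom I, e (e v) = e v) :
    t.HoldsIn (Atom.map e '' I) := by
  intro s hs
  have hsub : Atom.map e '' I ⊆ I := by
    rintro _ ⟨f, hf, rfl⟩
    exact he f hf
  obtain ⟨s', hs', hhd⟩ := ht s fun f hf => hsub (hs f hf)
  refine ⟨fun x => e (s' x), fun x hx => ?_, fun f hf => ⟨_, hhd f hf, rfl⟩⟩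
  obtain ⟨_, ⟨f, hf, rfl⟩, i, hi⟩ := hs.mem_adom hx
  simp only [hs' x hx, ← hi]
  exact hid _ (args_mem_adom hf i)

/-- Every finite pointed model is homomorphically equivalent to a finite pointed model all of whose
endomorphisms have an iterate that is the identity. -/
theorem exists_core {S : Schema} {V : Type*} {k : ℕ} {T : Set (TGD S)} (A : PointedInstance S V k)
    (hA : Models A.inst T) : ∃ A₁ : PointedInstance S V k, Models A₁.inst T ∧ A.MapsTo A₁ ∧
      A₁.MapsTo A ∧ ∀ h : V → V, IsHom h A₁.inst A₁.inst → (∀ i, h (A₁.pt i) = A₁.pt i) →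
        ∃ n, ∀ v ∈ adom A₁.inst, h^[n + 1] v = v := by
  obtain ⟨A₁, ⟨hT, h1, h2⟩, hmin⟩ := (measure fun A : PointedInstance S V k => A.inst.ncard).wf.has_min
    {A₁ | Models A₁.inst T ∧ A.MapsTo A₁ ∧ A₁.MapsTo A} ⟨A, hA, .refl A, .refl A⟩
  refine ⟨A₁, hT, h1, h2, fun h hh hpt => ?_⟩
  obtain ⟨n, hn⟩ := exists_iterate_idempotentOn (finite_adom A₁.finite_inst)
    (fun v hv => hh.mem_adom hv)
  have he := hh.iterate (n + 1)
  have hept : ∀ i, h^[n + 1] (A₁.pt i) = A₁.pt i := fun i => Function.iterate_fixed (hpt i) _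
  have hsub : Atom.map h^[n + 1] '' A₁.inst ⊆ A₁.inst := by
    rintro _ ⟨f, hf, rfl⟩
    exact he f hf
  have heI : IsHom h^[n + 1] A₁.inst (Atom.map h^[n + 1] '' A₁.inst) := fun f hf => ⟨f, hf, rfl⟩
  let A₂ : PointedInstance S V k := ⟨Atom.map h^[n + 1] '' A₁.inst, A₁.finite_inst.image _, A₁.pt,
    fun i => by
      rw [← hept i]
      exact heI.mem_adom (A₁.pt_mem i)⟩
  have hle : A₁.inst.ncard ≤ (Atom.map h^[n + 1] '' A₁.inst).ncard := by
    by_contra hlt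
    exact hmin A₂ ⟨fun t ht => (hT t ht).retract he hn, h1.trans ⟨_, heI, hept⟩,
      PointedInstance.MapsTo.trans ⟨id, fun f hf => hsub hf, fun _ => rfl⟩ h2⟩ (not_le.1 hlt)
  -- Minimality makes the retract all of `A₁`, and an idempotent is the identity on its image.
  have heq := Set.eq_of_subset_of_ncard_le hsub hle A₁.finite_inst
  refine ⟨n, fun v hv => ?_⟩
  rw [← heq] at hv
  obtain ⟨_, ⟨f, hf, rfl⟩, i, rfl⟩ := hv
  exact hn _ (args_mem_adom hf i)

/-! ### Twisted copies of an instance -/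

section Twist

variable {S : Schema} {V : Type*} (I : Instance S V) (f : Atom S V) (i : Fin (S.arity f.rel))
  (M : ℕ) (q : ℕ → V → V)

/-- Copies of `I`, in which the fact `f` connects each copy to every other one: position `i` of `f`
is taken from one copy, the other positions from another. -/
def twist : Instance S V :=
  {g' | (∃ g ∈ I, g ≠ f ∧ ∃ a < M, g' = g.map (q a)) ∨
    ∃ a < M, ∃ b < M, a ≠ b ∧ g' = ⟨f.rel, fun l => q (if l = i then a else b) (f.args l)⟩}

variable {I f i M q}

theorem finite_twist (hI : I.Finite) : (twist I f i M q).Finite := by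
  have h1 := (hI.prod (Set.finite_Iio M)).image fun p => p.1.map (q p.2)
  have h2 := ((Set.finite_Iio M).prod (Set.finite_Iio M)).image fun p =>
    (⟨f.rel, fun l => q (if l = i then p.1 else p.2) (f.args l)⟩ : Atom S V)
  refine (h1.union h2).subset ?_
  rintro g' (⟨g, hg, _, a, ha, rfl⟩ | ⟨a, ha, b, hb, _, rfl⟩)
  · exact Or.inl ⟨(g, a), ⟨hg, ha⟩, rfl⟩
  · exact Or.inr ⟨(a, b), ⟨ha, hb⟩, rfl⟩

/-- Two copies are needed: an element may occur only in `f`, which survives only between different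
copies. -/
theorem mem_adom_twist (hM : 2 ≤ M) {v : V} (hv : v ∈ adom I) {a : ℕ} (ha : a < M) :
    q a v ∈ adom (twist I f i M q) := by
  obtain ⟨g, hg, l, rfl⟩ := hv
  by_cases hgf : g = f
  · subst hgf
    obtain ⟨b, hb, hab⟩ : ∃ b < M, a ≠ b := by
      by_cases h : a = 0
      · exact ⟨1, by omega, by omega⟩
      · exact ⟨0, by omega, h⟩
    by_cases hl : l = i
    · exact ⟨_, Or.inr ⟨a, ha, b, hb, hab, rfl⟩, l, by simp only [if_pos hl]⟩
    · exact ⟨_, Or.inr ⟨b, hb, a, ha, hab.symm, rfl⟩, l, by simp only [if_neg hl]⟩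
  · exact ⟨_, Or.inl ⟨g, hg, hgf, a, ha, rfl⟩, l, rfl⟩

variable {p : V → V}

theorem isHom_twist (hpq : ∀ a v, p (q a v) = v) (hf : f ∈ I) : IsHom p (twist I f i M q) I := by
  rintro g' (⟨g, hg, _, a, ha, rfl⟩ | ⟨a, ha, b, hb, _, rfl⟩)
  · rw [Atom.map_map, Atom.map_eq_self fun l => hpq _ _]
    exact hg
  · have : (⟨f.rel, fun l => q (if l = i then a else b) (f.args l)⟩ : Atom S V).map p = f := by
      simp only [Atom.map, hpq]
    rw [this]
    exact hf

theorem exists_copy_of_mem_adom_twist (hpq : ∀ a v, p (q a v) = v) {v : V}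
    (hv : v ∈ adom (twist I f i M q)) :
    ∃ a < M, v = q a (p v) := by
  obtain ⟨g', ⟨g, hg, _, a, ha, rfl⟩ | ⟨a, ha, b, hb, _, rfl⟩, l, rfl⟩ := hv
  · exact ⟨a, ha, by simp only [Atom.map, hpq]⟩
  · simp only [hpq]
    by_cases hl : l = i
    · exact ⟨a, ha, by simp only [if_pos hl]⟩
    · exact ⟨b, hb, by simp only [if_neg hl]⟩

/-- Project the match to `I` and apply the TGD there. The unary head facts exist in every copy,
since none of them is `f`; a body variable keeps its copy and an existential one goes to copy `0`.
-/
theorem TGD.HoldsIn.twist (hpq : ∀ a v, p (q a v) = v) (hf : f ∈ I) (hM : 0 < M)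
    (hfar : S.arity f.rel ≠ 1) {t : TGD S} (hmon : t.IsMonadic) (ht : t.HoldsIn I) :
    t.HoldsIn (twist I f i M q) := by
  classical
  intro s hs
  obtain ⟨s', hs', hhd⟩ := ht (fun x => p (s x)) ((isHom_twist hpq hf).comp hs)
  have hval : ∀ x, ∃ a < M, (if x ∈ adom t.body then s x else q 0 (s' x)) = q a (s' x) := by
    intro x
    by_cases hx : x ∈ adom t.body
    · simp only [if_pos hx, hs' x hx]
      exact exists_copy_of_mem_adom_twist hpq (hs.mem_adom hx)
    · exact ⟨0, hM, if_neg hx⟩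
  refine ⟨fun x => if x ∈ adom t.body then s x else q 0 (s' x), fun x hx => if_pos hx,
    fun g hg => ?_⟩
  have h1 := hmon g hg
  obtain ⟨a, ha, e⟩ := hval (g.args ⟨0, by omega⟩)
  refine Or.inl ⟨g.map s', hhd g hg, fun e => hfar (e ▸ h1), a, ha, ?_⟩
  rw [Atom.map_map]
  refine Atom.map_congr fun l => ?_
  rw [show l = ⟨0, by omega⟩ from Fin.ext (by omega)]
  exact e

/-- A section `h` of the projection sends each fact to one lying over it. A fact other than `f`
stays within one copy, and copies are disjoint off `X`, so the copy is constant along a link that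
avoids `f`; yet `h` puts positions `i` and `j` of `f` into different copies. -/
theorem not_conn_of_section_twist (hpq : ∀ a v, p (q a v) = v) (hf : f ∈ I) {X : Set V}
    (hq : ∀ a b v, v ∉ X → q a v = q b v → a = b) {h : V → V} (hh : IsHom h I (twist I f i M q))
    (hph : ∀ v ∈ adom I, p (h v) = v) {j : Fin (S.arity f.rel)} (hij : i ≠ j)
    (hj : f.args j ∉ X) : ¬ Conn (I \ {f}) X (f.args i) (f.args j) := by
  have hpg : ∀ g ∈ I, (g.map h).map p = g := fun g hg => by
    rw [Atom.map_map]
    exact Atom.map_eq_self fun l => hph _ (args_mem_adom hg l)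
  have hpq' : ∀ a b, (⟨f.rel, fun l => q (if l = i then a else b) (f.args l)⟩ : Atom S V).map p = f :=
    fun a b => by simp only [Atom.map, hpq]
  have hstep : ∀ g ∈ I, g ≠ f → ∃ a, ∀ l, h (g.args l) = q a (g.args l) := by
    intro g hg hgf
    rcases hh g hg with ⟨g₁, _, _, a, _, e⟩ | ⟨a, _, b, _, _, e⟩
    · have e1 := congrArg (Atom.map p) e
      rw [hpg g hg, Atom.map_map, Atom.map_eq_self fun l => hpq _ _] at e1
      subst e1
      exact ⟨a, Atom.args_eq_of_map_eq e⟩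
    · have e1 := congrArg (Atom.map p) e
      rw [hpg g hg, hpq'] at e1
      exact absurd e1 hgf
  have hcopy : ∀ x y, Conn (I \ {f}) X x y → ∀ a, h x = q a x → h y = q a y := by
    intro x y hxy a hx
    induction hxy with
    | refl => exact hx
    | tail _ hbc ih =>
      obtain ⟨hb, _, g, ⟨hg, hgf⟩, ⟨l, rfl⟩, ⟨l', rfl⟩⟩ := hbc
      obtain ⟨a', ha'⟩ := hstep g hg hgf
      rw [hq a a' _ hb (ih.symm.trans (ha' l))]
      exact ha' l'
  intro hc
  rcases hh f hf with ⟨g₁, _, hg₁, a, _, e⟩ | ⟨a, _, b, _, hab, e⟩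
  · have e1 := congrArg (Atom.map p) e
    rw [hpg f hf, Atom.map_map, Atom.map_eq_self fun l => hpq _ _] at e1
    exact hg₁ e1.symm
  · have hl : ∀ l, h (f.args l) = q (if l = i then a else b) (f.args l) := by
      simp only [Atom.map, Atom.mk.injEq, heq_eq_eq, true_and] at e
      exact congrFun e
    have h1 := hcopy _ _ hc a (by rw [hl i, if_pos rfl])
    rw [hl j, if_neg hij.symm] at h1
    exact hab (hq _ _ _ hj h1).symm

/-- If there are more copies than maps from `I` to a finite instance, a homomorphism from the
twisted copies to that instance yields one from `I`. -/
theorem exists_isHom_of_isHom_twist (hI : I.Finite) {E : Set V} (hE : E.Finite)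
    (hM : Nat.card (adom I → E) + 2 ≤ M) {B : Instance S V} (hBE : adom B ⊆ E) {h : V → V}
    (hh : IsHom h (twist I f i M q) B) : ∃ a < M, IsHom (fun v => h (q a v)) I B := by
  have := hE.to_subtype
  have := (finite_adom hI).to_subtype
  let χ : Fin M → adom I → E := fun a v =>
    ⟨h (q a v), hBE (hh.mem_adom (mem_adom_twist (by omega) v.2 a.2))⟩
  obtain ⟨a, b, hab, e⟩ : ∃ a b, a ≠ b ∧ χ a = χ b := by
    by_contra! hne
    have := Nat.card_le_card_of_injective χ fun a b e => by_contra fun h => hne a b h e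
    rw [Nat.card_fin] at this
    omega
  refine ⟨a, a.2, fun g hg => ?_⟩
  by_cases hgf : g = f
  · subst hgf
    have hmem : (⟨g.rel, fun l => q (if l = i then a else b) (g.args l)⟩ : Atom S V) ∈
        twist I g i M q := Or.inr ⟨a, a.2, b, b.2, fun h => hab (Fin.ext h), rfl⟩
    have e1 : g.map (fun v => h (q a v)) =
        (⟨g.rel, fun l => q (if l = i then a else b) (g.args l)⟩ : Atom S V).map h := by
      unfold Atom.map
      congr 1
      funext l
      by_cases hl : l = i
      · simp only [if_pos hl]
      · simp only [if_neg hl]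
        exact congrArg Subtype.val (congrFun e ⟨_, args_mem_adom hg l⟩)
    rw [e1]
    exact hh _ hmem
  · exact hh _ (Or.inl ⟨g, hg, hgf, a, a.2, rfl⟩)

end Twist

/-! ### From finite duality to c-acyclicity -/

theorem nonempty_prod_nat_equiv (V : Type*) [Infinite V] : Nonempty (V × ℕ ≃ V) := by
  refine Cardinal.lift_mk_eq'.1 ?_
  simp [Cardinal.mk_prod, Cardinal.aleph0_le_mk]

theorem cAcyclic_of_hasFiniteDuality {S : Schema} {V : Type*} [Infinite V] {k : ℕ}
    {T : Set (TGD S)} (hmon : ∀ t ∈ T, t.IsMonadic) {F : Set (PointedInstance S V k)}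
    (hmod : ∀ A ∈ F, Models A.inst T) (hinc : ∀ A ∈ F, ∀ B ∈ F, A ≠ B → ¬ A.MapsTo B)
    (hF : HasFiniteDuality T F) {A : PointedInstance S V k} (hA : A ∈ F) :
    ∃ A' : PointedInstance S V k, A'.CAcyclic ∧ EquivUniversalSolution T A A' := by
  classical
  obtain ⟨D, hD, _, hdual⟩ := hF
  obtain ⟨A₁, hT₁, h01, h10, hcore⟩ := exists_core A (hmod A hA)
  refine ⟨A₁, ForestOff.everyCycleMeets fun f hf i j hij hi hj => ?_, A₁.inst,
    ⟨⟨subset_rfl, hT₁⟩, fun J' hJ' => ⟨id, fun f hf => hJ'.1 hf, fun _ _ => rfl⟩⟩, h01, h10⟩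
  let X := Set.range A₁.pt
  let E : Set V := ⋃ B ∈ D, adom B.inst
  have hE : E.Finite := hD.biUnion fun B _ => finite_adom B.finite_inst
  -- More copies than maps from `adom A₁` to `E`, for the pigeonhole, and at least two even if there
  -- are no such maps.
  let M := Nat.card (adom A₁.inst → E) + 2
  obtain ⟨e⟩ := nonempty_prod_nat_equiv V
  -- Copy `a` of a value; the distinguished elements are shared by all copies.
  let q : ℕ → V → V := fun a v => e (v, if v ∈ X then 0 else a)
  let p : V → V := fun v => (e.symm v).1
  have hpq : ∀ a v, p (q a v) = v := fun a v => by simp [p, q]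
  have hq : ∀ a b v, v ∉ X → q a v = q b v → a = b := by
    intro a b v hv h
    simpa [q, hv] using h
  have hqX : ∀ a i, q a (A₁.pt i) = q 0 (A₁.pt i) := by
    intro a i
    have : A₁.pt i ∈ X := ⟨i, rfl⟩
    simp [q, this]
  let C : PointedInstance S V k := ⟨twist A₁.inst f i M q, finite_twist A₁.finite_inst,
    fun i => q 0 (A₁.pt i), fun i => mem_adom_twist (by omega) (A₁.pt_mem i) (by omega)⟩
  have hfar : S.arity f.rel ≠ 1 := fun h => hij (Fin.ext (by omega))
  have hCT : Models C.inst T := fun t ht =>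
    (hT₁ t ht).twist hpq hf (by omega) hfar (hmon t ht)
  have hp : IsHom p C.inst A₁.inst := isHom_twist hpq hf
  have hCA : C.MapsTo A := PointedInstance.MapsTo.trans ⟨p, hp, fun i => hpq _ _⟩ h10
  have hFC : ∃ A ∈ F, A.MapsTo C := by
    refine (hdual C hCT).2 ?_
    rintro ⟨B, hB, h, hh, hpt⟩
    obtain ⟨a, _, ha⟩ := exists_isHom_of_isHom_twist A₁.finite_inst hE le_rfl
      (fun v hv => Set.mem_biUnion hB hv) hh
    refine (hdual A (hmod A hA)).1 ⟨A, hA, .refl A⟩ ⟨B, hB, h01.trans ⟨_, ha, fun i => ?_⟩⟩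
    simp only [hqX]
    exact hpt i
  obtain ⟨A₂, hA₂, hA₂C⟩ := hFC
  have hAA : A₂ = A := by_contra fun hne => hinc A₂ hA₂ A hA hne (hA₂C.trans hCA)
  subst hAA
  obtain ⟨h, hh, hpt⟩ := h10.trans hA₂C
  obtain ⟨n, hn⟩ := hcore (fun v => p (h v)) (hp.comp hh) fun i => by
    simp only [hpt]
    exact hpq _ _
  -- With `r = p ∘ h`, an endomorphism of the core with `r^[n + 1]` the identity on `adom A₁`, the
  -- map `h ∘ r^[n]` is a section of `p`.
  refine not_conn_of_section_twist hpq hf hq (h := fun v => h ((fun v => p (h v))^[n] v))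
    (IsHom.comp hh ((hp.comp hh).iterate n)) (fun v hv => ?_) hij hj
  have := hn v hv
  rwa [Function.iterate_succ_apply'] at this

end TGDDuality

theorem mainTheorem9 (S : TGDDuality.Schema) [Finite S.Rel] {V : Type*} [Infinite V] (k : ℕ)
    (T : Set (TGDDuality.TGD S)) (hT : T.Finite)
    (hmon : ∀ t ∈ T, t.IsMonadic) (htree : ∀ t ∈ T, t.IsTreeShaped)
    (F : Set (TGDDuality.PointedInstance S V k)) (hF : F.Finite)
    (hmod : ∀ A ∈ F, TGDDuality.Models A.inst T)
    (hinc : ∀ A ∈ F, ∀ B ∈ F, A ≠ B → ¬ A.MapsTo B) :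
    TGDDuality.HasFiniteDuality T F ↔
      ∀ A ∈ F, ∃ A' : TGDDuality.PointedInstance S V k,
        A'.CAcyclic ∧ TGDDuality.EquivUniversalSolution T A A' :=
  ⟨fun h _ hA => TGDDuality.cAcyclic_of_hasFiniteDuality hmon hmod hinc h hA,
    fun h => TGDDuality.hasFiniteDuality_of_cAcyclic hT hmon htree hF h⟩
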